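/- Let $n\ge 1$, and let $\mathcal{H}^{n-1}$ be the $(n-1)$-dimensional Hausdorff measure (so that it is the usual surface measure on the unit sphere $S^{n-1}\subset\mathbb{R}^n$). Let $\mathcal{K}_o^n$ be the set of compact convex sets in $\mathbb{R}^n$ containing the origin in their interiors, with the Hausdorff metric. For $K\in\mathcal{K}_o^n$, let $h_K(u)=\max_{x\in K}\langle u,x\rangle$ and $\rho_K(u)=\max\{\lambda>0:\lambda u\in K\}$ for $u\in S^{n-1}$. A vector $v\in S^{n-1}$ is an outer unit normal of $K$ at $x\in\partial K$ if $\langle v,x\rangle=h_K(v)$; $x$ is regular if there is only one such $v$, which is then denoted by $\nu_K(x)$. For $u\in S^{n-1}$ such that $\rho_K(u)u$ is regular (which holds for $\mathcal{H}^{n-1}$-almost every $u$), put $\alpha_K(u)=\nu_K(\rho_K(u)u)$. For $E\subset S^{n-1}$, let $\boldsymbol{\alpha}^*_K(E)$ be the set of all $x/|x|$ such that $x\in\partial K$ has an outer unit normal in $E$. The surface area measure of $K$ is $S(K,E)=\mathcal{H}^{n-1}(\{x\in\partial K: x\text{ regular},\ \nu_K(x)\in E\})$ for Borel sets $E\subset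 S^{n-1}$. Let $G:(0,\infty)\times S^{n-1}\to\mathbb{R}$ be continuous, with a partial derivative $G_t(t,u)=\partial G(t,u)/\partial t$ that exists and is continuous on $(0,\infty)\times S^{n-1}$, and let $\psi:(0,\infty)\to(0,\infty)$ be continuous. For $K\in\mathcal{K}_o^n$, the general dual Orlicz curvature measure is the (well-defined) finite signed Borel measure on $S^{n-1}$ given by $$\widetilde{C}_{G,\psi}(K,E)=\frac1n\int_{\boldsymbol{\alpha}^*_K(E)}\frac{\rho_K(u)\,G_t(\rho_K(u),u)}{\psi(h_K(\alpha_K(u)))}\,d\mathcal{H}^{n-1}(u)$$ for Borel sets $E\subset S^{n-1}$; here $\boldsymbol{\alpha}^*_K(E)$ is $\mathcal{H}^{n-1}$-measurable and the integrand is integrable on $S^{n-1}$. Let $K\in\mathcal{K}_o^n$. The following statements hold. (i) $\widetilde{C}_{G,\psi}(K,\cdot)$ is absolutely continuous with respect to $S(K,\cdot)$. (ii) If $K_i\in\mathcal{K}_o^n$, $i\in\mathbb{N}$, and $K_i\to K$ in the Hausdorff metric, then $\widetilde{C}_{G,\psi}(K_i,\cdot)\to\widetilde{C}_{G,\psi}(K,\cdot)$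 weakly, that is, $\int g\,d\widetilde{C}_{G,\psi}(K_i,\cdot)\to\int g\,d\widetilde{C}_{G,\psi}(K,\cdot)$ for every continuous $g:S^{n-1}\to\mathbb{R}$. (iii) If $G_t>0$ on $(0,\infty)\times S^{n-1}$ (or $G_t<0$ on $(0,\infty)\times S^{n-1}$), then $\mu=\widetilde{C}_{G,\psi}(K,\cdot)$ (or $\mu=-\widetilde{C}_{G,\psi}(K,\cdot)$, respectively) is a nonzero finite Borel measure not concentrated on any closed hemisphere, that is, $\int_{S^{n-1}}\max\{\langle u,v\rangle,0\}\,d\mu(u)>0$ for every $v\in S^{n-1}$. -/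

import Mathlib

open MeasureTheory Set Filter Topology
open scoped RealInnerProductSpace

namespace DualOrlicz

/-- Euclidean space `ℝⁿ`. -/
abbrev Euc (n : ℕ) : Type := EuclideanSpace ℝ (Fin n)

/-- The unit sphere `S^{n-1}` in `ℝⁿ`. -/
abbrev Sph (n : ℕ) : Type := Metric.sphere (0 : Euc n) 1

/-- Convex bodies in `ℝⁿ` containing the origin in their interiors, with the Hausdorff metric
(inherited from Mathlib's metric on `ConvexBody`). -/
abbrev BodyO (n : ℕ) : Type := {K : ConvexBody (Euc n) // (0 : Euc n) ∈ interior (K : Set (Euc n))}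

/-- The boundary `∂K`. -/
def bd {n : ℕ} (K : BodyO n) : Set (Euc n) := frontier (K.1 : Set (Euc n))

/-- The support function `h_K(u) = sup {⟨u, x⟩ : x ∈ K}`. -/
noncomputable def supp {n : ℕ} (K : BodyO n) (u : Euc n) : ℝ :=
  sSup ((fun x : Euc n => ⟪u, x⟫) '' (K.1 : Set (Euc n)))

/-- The radial function `ρ_K(x) = sup {l > 0 : l x ∈ K}` (used for `x ≠ 0`). -/
noncomputable def radial {n : ℕ} (K : BodyO n) (x : Euc n) : ℝ :=
  sSup {l : ℝ | 0 < l ∧ l • x ∈ (K.1 : Set (Euc n))}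

/-- The supporting hyperplane `H(K, u)`. -/
def hyperplane {n : ℕ} (K : BodyO n) (u : Sph n) : Set (Euc n) :=
  {x | ⟪(u : Euc n), x⟫ = supp K u}

/-- The set-valued Gauss map (for `A ⊆ ∂K`): all outer unit normals at points of `A`. -/
def normals {n : ℕ} (K : BodyO n) (A : Set (Euc n)) : Set (Sph n) :=
  {u | ∃ x ∈ A, x ∈ hyperplane K u}

/-- The set-valued reverse Gauss map: all boundary points with an outer unit normal in `A`. -/
def normalPoints {n : ℕ} (K : BodyO n) (A : Set (Sph n)) : Set (Euc n) :=
  {x | x ∈ bd K ∧ ∃ u ∈ A, x ∈ hyperplane K u}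

/-- The set-valued radial Gauss map: all outer unit normals at the points `ρ_K(u) u`, `u ∈ A`. -/
noncomputable def radialNormals {n : ℕ} (K : BodyO n) (A : Set (Sph n)) : Set (Sph n) :=
  normals K ((fun u : Sph n => radial K u • (u : Euc n)) '' A)

/-- The set-valued reverse radial Gauss map:
all directions `x / |x|` of boundary points `x` with an outer unit normal in `A`. -/
def reverseRadial {n : ℕ} (K : BodyO n) (A : Set (Sph n)) : Set (Sph n) :=
  {w | ∃ x ∈ normalPoints K A, (w : Euc n) = ‖x‖⁻¹ • x}

/-- The radial Gauss map `α_K`: the unique outer unit normal at `ρ_K(u) u`.  Where this normal is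
not unique (on a null set of `u`) the value is arbitrary. -/
noncomputable def radialGauss {n : ℕ} (K : BodyO n) (u : Sph n) : Sph n :=
  open Classical in if h : ∃ v, radialNormals K {u} = {v} then h.choose else u

/-- Singular boundary points: those with two or more outer unit normals. -/
def singularPoints {n : ℕ} (K : BodyO n) : Set (Euc n) :=
  {x | x ∈ bd K ∧ (normals K {x}).Nontrivial}

/-- Regular boundary points. -/
def reg {n : ℕ} (K : BodyO n) : Set (Euc n) := bd K \ singularPoints K

theorem supp_bddAbove {n : ℕ} (K : BodyO n) (u : Euc n) :
    BddAbove ((fun x : Euc n => ⟪u, x⟫) '' (K.1 : Set (Euc n))) :=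
  (K.1.isCompact.image (by fun_prop)).bddAbove

theorem mem_hyperplane_iff {n : ℕ} (K : BodyO n) (u : Sph n) {x : Euc n}
    (hx : x ∈ (K.1 : Set (Euc n))) :
    x ∈ hyperplane K u ↔ ∀ y ∈ (K.1 : Set (Euc n)), ⟪(u : Euc n), y⟫ ≤ ⟪(u : Euc n), x⟫ := by
  constructor
  · intro h y hy
    have h' : ⟪(u : Euc n), x⟫ = supp K u := h
    rw [h']
    exact le_csSup (supp_bddAbove K u) (mem_image_of_mem _ hy)
  · intro h
    refine le_antisymm (le_csSup (supp_bddAbove K u) (mem_image_of_mem _ hx)) ?_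
    refine csSup_le (K.1.nonempty.image _) ?_
    rintro _ ⟨y, hy, rfl⟩
    exact h y hy

theorem bd_subset {n : ℕ} (K : BodyO n) : bd K ⊆ (K.1 : Set (Euc n)) :=
  K.1.isClosed.frontier_subset

/-- Every boundary point has an outer unit normal. -/
theorem normals_nonempty {n : ℕ} (K : BodyO n) {x : Euc n} (hx : x ∈ bd K) :
    (normals K {x}).Nonempty := by
  have hxi : x ∉ interior (K.1 : Set (Euc n)) := hx.2
  obtain ⟨f, hf⟩ := geometric_hahn_banach_open_point K.1.convex.interior isOpen_interior hxi
  set w : Euc n := (InnerProductSpace.toDual ℝ (Euc n)).symm f with hw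
  have hfw : ∀ y, f y = ⟪w, y⟫ := fun y => by
    rw [hw, InnerProductSpace.toDual_symm_apply]
  have hw0 : w ≠ 0 := by
    intro h0
    have := hf 0 K.2
    simp [hfw, h0] at this
  have hwn : 0 < ‖w‖ := norm_pos_iff.mpr hw0
  have hle : ∀ y ∈ (K.1 : Set (Euc n)), ⟪w, y⟫ ≤ ⟪w, x⟫ := by
    intro y hy
    have hcl : y ∈ closure (interior (K.1 : Set (Euc n))) := by
      rw [K.1.convex.closure_interior_eq_closure_of_nonempty_interior ⟨0, K.2⟩]
      exact subset_closure hy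
    have hc : IsClosed {z : Euc n | ⟪w, z⟫ ≤ ⟪w, x⟫} :=
      isClosed_le (by fun_prop) continuous_const
    refine hc.closure_subset_iff.mpr ?_ hcl
    intro z hz
    have := (hf z hz).le
    simpa [hfw] using this
  refine ⟨⟨‖w‖⁻¹ • w, by simp [norm_smul, hwn.ne']⟩, x, rfl, ?_⟩
  rw [mem_hyperplane_iff K _ (bd_subset K hx)]
  intro y hy
  simp only [real_inner_smul_left]
  exact mul_le_mul_of_nonneg_left (hle y hy) (by positivity)

/-- A regular boundary point has exactly one outer unit normal. -/
theorem reg_existsUnique {n : ℕ} (K : BodyO n) (x : reg K) : ∃ v, normals K {(x : Euc n)} = {v} := by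
  obtain ⟨v, hv⟩ := normals_nonempty K x.2.1
  refine ⟨v, ?_⟩
  have hs : (normals K {(x : Euc n)}).Subsingleton := by
    rw [← not_nontrivial_iff]
    exact fun h => x.2.2 ⟨x.2.1, h⟩
  exact hs.eq_singleton_of_mem hv

/-- The Gauss map `ν_K` on regular boundary points: the unique outer unit normal. -/
noncomputable def gauss {n : ℕ} (K : BodyO n) (x : reg K) : Sph n := (reg_existsUnique K x).choose

theorem gauss_spec {n : ℕ} (K : BodyO n) (x : reg K) : normals K {(x : Euc n)} = {gauss K x} :=
  (reg_existsUnique K x).choose_spec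

theorem gauss_eq_iff {n : ℕ} (K : BodyO n) (x : reg K) (u : Sph n) :
    gauss K x = u ↔ ∀ y ∈ (K.1 : Set (Euc n)), ⟪(u : Euc n), y⟫ ≤ ⟪(u : Euc n), (x : Euc n)⟫ := by
  rw [← mem_hyperplane_iff K u (bd_subset K x.2.1)]
  have h : (x : Euc n) ∈ hyperplane K u ↔ u ∈ normals K {(x : Euc n)} := by simp [normals]
  rw [h, gauss_spec, mem_singleton_iff, eq_comm]

theorem continuous_gauss {n : ℕ} (K : BodyO n) : Continuous (gauss K) := by
  rw [continuous_iff_isClosed]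
  intro C hC
  have hcl : IsClosed {p : reg K × Sph n | p.2 ∈ C ∧
      ∀ y ∈ (K.1 : Set (Euc n)), ⟪(p.2 : Euc n), y⟫ ≤ ⟪(p.2 : Euc n), (p.1 : Euc n)⟫} := by
    refine (hC.preimage continuous_snd).inter ?_
    have heq : {p : reg K × Sph n | ∀ y ∈ (K.1 : Set (Euc n)),
        ⟪(p.2 : Euc n), y⟫ ≤ ⟪(p.2 : Euc n), (p.1 : Euc n)⟫} =
        ⋂ y ∈ (K.1 : Set (Euc n)), {p : reg K × Sph n |
          ⟪(p.2 : Euc n), y⟫ ≤ ⟪(p.2 : Euc n), (p.1 : Euc n)⟫} := by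
      ext p
      simp
    change IsClosed {p : reg K × Sph n | ∀ y ∈ (K.1 : Set (Euc n)),
        ⟪(p.2 : Euc n), y⟫ ≤ ⟪(p.2 : Euc n), (p.1 : Euc n)⟫}
    rw [heq]
    exact isClosed_biInter fun y _ => isClosed_le (by fun_prop) (by fun_prop)
  have himg := isClosedMap_fst_of_compactSpace _ hcl
  convert! himg using 1
  ext x
  simp only [mem_preimage, mem_image, mem_ofPred_eq, Prod.exists, exists_and_right, exists_eq_right]
  constructor
  · intro h
    exact ⟨gauss K x, h, (gauss_eq_iff K x _).1 rfl⟩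
  · rintro ⟨u, hu, h⟩
    rw [(gauss_eq_iff K x u).2 h]
    exact hu

/-- The surface area measure `S(K, ·)`: the image under the Gauss map of the
`(n-1)`-dimensional Hausdorff measure (with Euclidean normalization) on the regular points. -/
noncomputable def surfaceArea {n : ℕ} (K : BodyO n) : Measure (Sph n) :=
  (μHE[n - 1] : Measure (reg K)).map (gauss K)

/-- `S(K, A)` is the `(n-1)`-dimensional Hausdorff measure of the inverse Gauss image of `A`. -/
theorem surfaceArea_apply {n : ℕ} (K : BodyO n) {A : Set (Sph n)} (hA : MeasurableSet A) :
    surfaceArea K A = (μHE[n - 1] : Measure (Euc n)) {x | ∃ h : x ∈ reg K, gauss K ⟨x, h⟩ ∈ A} := by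
  rw [surfaceArea, Measure.map_apply (continuous_gauss K).measurable hA,
    ← (isometry_subtype_coe (s := reg K)).euclideanHausdorffMeasure_image]
  congr 1
  ext x
  simp

/-- The density `ρ_K(u) G_t(ρ_K(u), u) / ψ(h_K(α_K(u)))` on the sphere. -/
noncomputable def density {n : ℕ} (G : ℝ → Sph n → ℝ) (ψ : ℝ → ℝ) (K : BodyO n) (u : Sph n) : ℝ :=
  radial K u * deriv (fun t => G t u) (radial K u) / ψ (supp K (radialGauss K u))

/-- The set function
`A ↦ (1/n) ∫_{α*_K(A)} ρ_K(u) G_t(ρ_K(u), u) / ψ(h_K(α_K(u))) du`,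
where `du` is the `(n-1)`-dimensional Hausdorff measure on the sphere. -/
noncomputable def curvatureValue {n : ℕ} (G : ℝ → Sph n → ℝ) (ψ : ℝ → ℝ) (K : BodyO n)
    (A : Set (Sph n)) : ℝ :=
  (1 / (n : ℝ)) * ∫ u in reverseRadial K A, density G ψ K u ∂(μHE[n - 1] : Measure (Sph n))

/-- The general dual Orlicz curvature measure: the signed Borel measure on the sphere whose value
on every Borel set `A` is `curvatureValue G ψ K A` (and `0` if there is no such signed measure). -/
noncomputable def curvatureMeasure {n : ℕ} (G : ℝ → Sph n → ℝ) (ψ : ℝ → ℝ) (K : BodyO n) :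
    SignedMeasure (Sph n) :=
  open Classical in
  if h : ∃ C : SignedMeasure (Sph n), ∀ A, MeasurableSet A → C A = curvatureValue G ψ K A
  then h.choose else 0

/-- A measure `μ` on the sphere is not concentrated on any closed hemisphere:
`∫ ⟨u, v⟩₊ dμ(u) > 0` for every unit vector `v`. -/
def NotInClosedHemisphere {n : ℕ} (μ : Measure (Sph n)) : Prop :=
  ∀ v : Sph n, 0 < ∫ u : Sph n, max ⟪(u : Euc n), (v : Euc n)⟫ 0 ∂μ

/-- Weak convergence of a sequence of signed measures on the sphere. -/
def WeakConv {n : ℕ} (C : ℕ → SignedMeasure (Sph n)) (D : SignedMeasure (Sph n)) : Prop :=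
  ∀ g : Sph n → ℝ, Continuous g →
    Tendsto (fun i => ∫ᵛ u, g u ∂•(C i)) atTop (𝓝 (∫ᵛ u, g u ∂•D))

end DualOrlicz

open DualOrlicz

namespace DualOrlicz

/-! ### The Hausdorff measure on the sphere -/

/-! Everything rests on one observation: for almost every direction `u` the normal at `ρ_K(u)u` is
unique, so `α*_K(A)` agrees with `α_K⁻¹(A)` up to a null set (`reverseRadial_ae_eq`). Hence the
curvature measure is the push-forward under `α_K` of `1/n` times the density, and integrals against
it become integrals over the fixed sphere (`curvatureMeasure_spec`).

Uniqueness almost everywhere comes from Rademacher's theorem. The gauge of `K` is Lipschitz, and for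
a normal `v` the vector `v / h_K(v)` is a subgradient of it; where the gauge, restricted to a
tangent hyperplane `e + e^⊥` of the sphere, is differentiable, only one such vector is possible.
Central projection from that hyperplane is Lipschitz and carries null sets to null sets of the
sphere.

(i) The radial projection of `∂K` to the sphere is Lipschitz, because `∂K` stays away from the
origin. So if the regular points with normal in `A` form a null set, then so do their directions,
and the integral over `α*_K(A)` vanishes.

(ii) If `K_i → K`, support and radial functions converge, and a cluster point of normals of `K_i` at
`u` is a normal of `K` at `u`. Thus `α_{K_i}(u) → α_K(u)` almost everywhere
(`tendsto_of_mem_radialNormals`), the densities are eventually uniformly bounded, and dominated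
convergence applies.

(iii) With `r ≤ h_K` and `ρ_K ≤ R`, a normal `w` at direction `u` has `⟨w, u⟩ ≥ r / R`. So `⟨α_K(u),
v⟩ > 0` for almost all `u` in a ball around `v`, which has positive measure, and there the integrand
is positive. -/

theorem euclideanHausdorffMeasure_image_le {X Y : Type*} [MetricSpace X] [MeasurableSpace X]
    [BorelSpace X] [MetricSpace Y] [MeasurableSpace Y] [BorelSpace Y] {f : X → Y} {C : NNReal}
    {s : Set X} (hf : LipschitzOnWith C f s) (d : ℕ) :
    (μHE[d] : Measure Y) (f '' s) ≤ (C : ENNReal) ^ d * (μHE[d] : Measure X) s := by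
  simp only [Measure.euclideanHausdorffMeasure_def, Measure.smul_apply, ENNReal.smul_def,
    smul_eq_mul]
  have h := hf.hausdorffMeasure_image_le (d := d) (by positivity)
  rw [ENNReal.rpow_natCast] at h
  calc _ ≤ _ := mul_le_mul_right h _
    _ = _ := by ring

/-- The difference of the normalizations splits into `(x - y) / ‖x‖` and `(1 / ‖x‖ - 1 / ‖y‖) y`.
Each has norm at most `‖x - y‖ / r`, whence the factor 2. -/
theorem lipschitzOnWith_normalize {E : Type*} [NormedAddCommGroup E] [NormedSpace ℝ E]
    {r : NNReal} (hr : 0 < r) :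
    LipschitzOnWith (2 / r) (fun x : E => ‖x‖⁻¹ • x) {x | (r : ℝ) ≤ ‖x‖} := by
  refine LipschitzOnWith.of_dist_le_mul fun x hx y hy => ?_
  have hr' : (0 : ℝ) < r := hr
  have hx0 : 0 < ‖x‖ := hr'.trans_le hx
  have hy0 : 0 < ‖y‖ := hr'.trans_le hy
  rw [dist_eq_norm, dist_eq_norm]
  have h1 : ‖x‖⁻¹ • x - ‖y‖⁻¹ • y = ‖x‖⁻¹ • (x - y) + (‖x‖⁻¹ * (‖y‖ - ‖x‖) * ‖y‖⁻¹) • y := by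
    have : ‖x‖⁻¹ * (‖y‖ - ‖x‖) * ‖y‖⁻¹ = ‖x‖⁻¹ - ‖y‖⁻¹ := by field_simp
    rw [this, smul_sub, sub_smul]
    abel
  have h2 : |‖y‖ - ‖x‖| ≤ ‖x - y‖ := by
    rw [norm_sub_rev]
    exact abs_norm_sub_norm_le y x
  calc ‖‖x‖⁻¹ • x - ‖y‖⁻¹ • y‖
      ≤ ‖x‖⁻¹ * ‖x - y‖ + ‖x‖⁻¹ * |‖y‖ - ‖x‖| := by
        rw [h1]
        refine (norm_add_le _ _).trans (le_of_eq ?_)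
        rw [norm_smul, norm_smul, norm_mul, norm_mul, norm_inv, norm_inv, norm_norm, norm_norm,
          Real.norm_eq_abs]
        field_simp
    _ ≤ ‖x‖⁻¹ * ‖x - y‖ + ‖x‖⁻¹ * ‖x - y‖ := by gcongr
    _ = 2 * ‖x‖⁻¹ * ‖x - y‖ := by ring
    _ ≤ 2 * (r : ℝ)⁻¹ * ‖x - y‖ := by gcongr; exact hx
    _ = _ := by push_cast; ring

theorem sphere_measure_eq {n : ℕ} (A : Set (Sph n)) :
    (μHE[n - 1] : Measure (Sph n)) A = (μHE[n - 1] : Measure (Euc n)) ((↑) '' A) :=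
  (isometry_subtype_coe.euclideanHausdorffMeasure_image A).symm

/-- Serves two choices of `S`: pieces of a tangent hyperplane, where `r = 1`, and pieces of `∂K`,
where `r` is a lower bound of `ρ_K`. -/
theorem sphere_measure_le_of_normalize {n : ℕ} {A : Set (Sph n)} {S : Set (Euc n)} {r : NNReal}
    (hr : 0 < r) (hS : ∀ x ∈ S, (r : ℝ) ≤ ‖x‖)
    (hA : ∀ u ∈ A, ∃ x ∈ S, (u : Euc n) = ‖x‖⁻¹ • x) :
    (μHE[n - 1] : Measure (Sph n)) A ≤
      ((2 / r : NNReal) : ENNReal) ^ (n - 1) * (μHE[n - 1] : Measure (Euc n)) S := by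
  rw [sphere_measure_eq]
  refine (measure_mono ?_).trans
    (euclideanHausdorffMeasure_image_le ((lipschitzOnWith_normalize hr).mono hS) (n - 1))
  rintro _ ⟨u, hu, rfl⟩
  obtain ⟨x, hx, h⟩ := hA u hu
  exact ⟨x, hx, h.symm⟩

theorem sphere_measure_eq_zero_of_normalize {n : ℕ} {A : Set (Sph n)} {S : Set (Euc n)} {r : NNReal}
    (hr : 0 < r) (hS : ∀ x ∈ S, (r : ℝ) ≤ ‖x‖)
    (hA : ∀ u ∈ A, ∃ x ∈ S, (u : Euc n) = ‖x‖⁻¹ • x)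
    (h0 : (μHE[n - 1] : Measure (Euc n)) S = 0) :
    (μHE[n - 1] : Measure (Sph n)) A = 0 := by
  have h := sphere_measure_le_of_normalize hr hS hA
  rw [h0, mul_zero] at h
  exact le_antisymm h zero_le

theorem finrank_orthogonal_span {n : ℕ} (e : Sph n) :
    Module.finrank ℝ (ℝ ∙ (e : Euc n))ᗮ = n - 1 := by
  have h := Submodule.finrank_add_finrank_orthogonal (ℝ ∙ (e : Euc n))
  have he : (e : Euc n) ≠ 0 := ne_zero_of_mem_unit_sphere e
  rw [finrank_span_singleton he, finrank_euclideanSpace_fin] at h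
  omega

theorem euclideanHausdorffMeasure_orthogonal {n : ℕ} (e : Sph n) :
    (μHE[n - 1] : Measure (ℝ ∙ (e : Euc n))ᗮ) = volume := by
  rw [← finrank_orthogonal_span e]
  exact InnerProductSpace.euclideanHausdorffMeasure_eq_volume

/-- Points `u` with `⟪e, u⟫ > 0` are the normalizations of points `e + z` with `z ⟂ e`. -/
theorem exists_orthogonal_eq_normalize {n : ℕ} (e u : Sph n) (h : 0 < ⟪(e : Euc n), u⟫) :
    ∃ z : (ℝ ∙ (e : Euc n))ᗮ, (e : Euc n) + z = ⟪(e : Euc n), u⟫⁻¹ • (u : Euc n) ∧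
      (u : Euc n) = ‖(e : Euc n) + z‖⁻¹ • ((e : Euc n) + z) := by
  have hz : ⟪(e : Euc n), u⟫⁻¹ • (u : Euc n) - e ∈ (ℝ ∙ (e : Euc n))ᗮ := by
    rw [Submodule.mem_orthogonal_singleton_iff_inner_right, inner_sub_right, real_inner_smul_right,
      real_inner_self_eq_norm_sq, norm_eq_of_mem_sphere]
    field_simp
    ring
  have h1 : (e : Euc n) + (⟪(e : Euc n), u⟫⁻¹ • (u : Euc n) - e) =
      ⟪(e : Euc n), u⟫⁻¹ • (u : Euc n) := by abel
  refine ⟨⟨_, hz⟩, h1, ?_⟩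
  simp only [h1, norm_smul, norm_eq_of_mem_sphere, norm_inv, Real.norm_of_nonneg h.le, mul_one,
    inv_inv, smul_smul]
  rw [mul_inv_cancel₀ h.ne', one_smul]

theorem one_le_norm_add_orthogonal {n : ℕ} (e : Sph n) (z : (ℝ ∙ (e : Euc n))ᗮ) :
    1 ≤ ‖(e : Euc n) + z‖ := by
  have h0 : ⟪(e : Euc n), (z : Euc n)⟫ = 0 :=
    (Submodule.mem_orthogonal_singleton_iff_inner_right).1 z.2
  have h1 : ⟪(e : Euc n), (e : Euc n) + z⟫ = 1 := by
    rw [inner_add_right, h0, real_inner_self_eq_norm_sq, norm_eq_of_mem_sphere]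
    norm_num
  have h2 := real_inner_le_norm (e : Euc n) ((e : Euc n) + z)
  rwa [h1, norm_eq_of_mem_sphere, one_mul] at h2

/-- The central projection from a tangent hyperplane does not increase measures by more than a
constant factor. -/
theorem sphere_measure_le_volume {n : ℕ} (e : Sph n) {A : Set (Sph n)}
    {T : Set (ℝ ∙ (e : Euc n))ᗮ}
    (hA : ∀ u ∈ A, ∃ z ∈ T, (u : Euc n) = ‖(e : Euc n) + z‖⁻¹ • ((e : Euc n) + z)) :
    (μHE[n - 1] : Measure (Sph n)) A ≤ ((2 / 1 : NNReal) : ENNReal) ^ (n - 1) * volume T := by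
  have hiso : Isometry fun z : (ℝ ∙ (e : Euc n))ᗮ => (e : Euc n) + z :=
    Isometry.of_dist_eq fun x y => by simp [Subtype.dist_eq]
  have h := sphere_measure_le_of_normalize (A := A)
    (S := (fun z : (ℝ ∙ (e : Euc n))ᗮ => (e : Euc n) + z) '' T) (r := 1) one_pos
    (by rintro _ ⟨z, -, rfl⟩; simpa using one_le_norm_add_orthogonal e z)
    (fun u hu => by
      obtain ⟨z, hz, h⟩ := hA u hu
      exact ⟨_, ⟨z, hz, rfl⟩, h⟩)
  rwa [hiso.euclideanHausdorffMeasure_image, euclideanHausdorffMeasure_orthogonal] at h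

theorem inner_self_sph {n : ℕ} (u : Sph n) : ⟪(u : Euc n), (u : Euc n)⟫ = 1 := by
  rw [real_inner_self_eq_norm_sq, norm_eq_of_mem_sphere]
  norm_num

/-- By compactness local finiteness suffices. The cap `⟨e, u⟩ > 1/2` is covered by the central
projection of a ball in the tangent hyperplane, of radius 3 because `‖u / ⟨e, u⟩ - e‖ ≤ 2 + 1`. -/
instance isFiniteMeasure_sphere {n : ℕ} : IsFiniteMeasure (μHE[n - 1] : Measure (Sph n)) := by
  refine ⟨isCompact_univ.measure_lt_top_of_nhdsWithin fun e _ => ?_⟩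
  refine ⟨{u : Sph n | 1 / 2 < ⟪(e : Euc n), u⟫}, ?_, ?_⟩
  · refine mem_nhdsWithin_of_mem_nhds (IsOpen.mem_nhds (isOpen_lt (by fun_prop) (by fun_prop)) ?_)
    change 1 / 2 < ⟪(e : Euc n), (e : Euc n)⟫
    rw [inner_self_sph]
    norm_num
  · refine (sphere_measure_le_volume e (T := Metric.closedBall 0 3) fun u hu => ?_).trans_lt ?_
    · have hu' : 1 / 2 < ⟪(e : Euc n), u⟫ := hu
      obtain ⟨z, hz, h⟩ := exists_orthogonal_eq_normalize e u (by linarith)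
      refine ⟨z, ?_, h⟩
      rw [mem_closedBall_zero_iff]
      have hz' : (z : Euc n) = ⟪(e : Euc n), u⟫⁻¹ • (u : Euc n) - e := by rw [← hz]; abel
      change ‖(z : Euc n)‖ ≤ 3
      rw [hz']
      refine (norm_sub_le _ _).trans ?_
      rw [norm_smul, norm_eq_of_mem_sphere, norm_eq_of_mem_sphere, norm_inv,
        Real.norm_of_nonneg (by linarith)]
      have : ⟪(e : Euc n), u⟫⁻¹ ≤ (1 / 2)⁻¹ := inv_anti₀ (by norm_num) hu'.le
      norm_num at this
      linarith
    · exact ENNReal.mul_lt_top (by simp) measure_closedBall_lt_top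

/-- Orthogonal projection to `v^⊥` does not increase the measure, and the image of the ball contains
a neighbourhood of 0: nearby `y` lift to `y + √(1 - ‖y‖²) v` on the sphere. -/
theorem sphere_measure_ball_pos {n : ℕ} (v : Sph n) {ε : ℝ} (hε : 0 < ε) :
    0 < (μHE[n - 1] : Measure (Sph n)) (Metric.ball v ε) := by
  set F := (ℝ ∙ (v : Euc n))ᗮ with hF
  have hP : LipschitzWith 1 (F.orthogonalProjectionOnto) := by
    refine LipschitzWith.of_dist_le_mul fun x y => ?_
    rw [dist_eq_norm, dist_eq_norm, ← map_sub, NNReal.coe_one, one_mul]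
    exact F.norm_orthogonalProjectionOnto_apply_le _
  set lift : F → Euc n := fun y => (y : Euc n) + √(1 - ‖y‖ ^ 2) • (v : Euc n) with hlift
  have hlc : Continuous lift := by fun_prop
  have hvF : (v : Euc n) ∈ Fᗮ :=
    Submodule.le_orthogonal_orthogonal _ (Submodule.mem_span_singleton_self _)
  set U : Set F := {y | ‖y‖ < 1} ∩ lift ⁻¹' Metric.ball (v : Euc n) ε with hU
  have hUo : IsOpen U := (isOpen_lt (by fun_prop) (by fun_prop)).inter
    (Metric.isOpen_ball.preimage hlc)
  have hU0 : (0 : F) ∈ U := by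
    refine ⟨by simp, ?_⟩
    simp [hlift, hε]
  have hpos : 0 < volume U := hUo.measure_pos _ ⟨0, hU0⟩
  have hsub : U ⊆ F.orthogonalProjectionOnto '' ((↑) '' Metric.ball v ε) := by
    rintro y ⟨hy1, hy2⟩
    have hy0 : ⟪(y : Euc n), (v : Euc n)⟫ = 0 :=
      (Submodule.mem_orthogonal_singleton_iff_inner_left).1 y.2
    have hn : ‖lift y‖ = 1 := by
      have h1 : ‖lift y‖ ^ 2 = 1 := by
        have hy1' : ‖y‖ < 1 := hy1
        rw [hlift, norm_add_sq_real, real_inner_smul_right, hy0, norm_smul, norm_eq_of_mem_sphere,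
          Real.norm_of_nonneg (Real.sqrt_nonneg _), mul_one,
          Real.sq_sqrt (by nlinarith [norm_nonneg y])]
        simp
      nlinarith [norm_nonneg (lift y)]
    refine ⟨lift y, ⟨⟨lift y, by simpa using hn⟩, hy2, rfl⟩, ?_⟩
    rw [hlift, map_add, map_smul, Submodule.orthogonalProjectionOnto_mem_subspace_eq_self,
      Submodule.orthogonalProjectionOnto_apply_of_mem_orthogonal hvF, smul_zero, add_zero]
  rw [sphere_measure_eq]
  have h := euclideanHausdorffMeasure_image_le
    (hP.lipschitzOnWith (s := ((↑) '' Metric.ball v ε : Set (Euc n)))) (n - 1)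
  rw [euclideanHausdorffMeasure_orthogonal, ENNReal.coe_one, one_pow, one_mul] at h
  exact (hpos.trans_le (measure_mono hsub)).trans_le h

end DualOrlicz

namespace DualOrlicz

/-! ### Support function, radial function and gauge -/

section Bodies

variable {n : ℕ}

theorem body_mem_nhds (K : BodyO n) : (K.1 : Set (Euc n)) ∈ 𝓝 (0 : Euc n) :=
  mem_interior_iff_mem_nhds.1 K.2

theorem gauge_le_one_iff (K : BodyO n) (x : Euc n) :
    gauge (K.1 : Set (Euc n)) x ≤ 1 ↔ x ∈ (K.1 : Set (Euc n)) := by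
  rw [gauge_le_one_iff_mem_closure K.1.convex (body_mem_nhds K), K.1.isClosed.closure_eq]

theorem gauge_eq_one_iff (K : BodyO n) (x : Euc n) :
    gauge (K.1 : Set (Euc n)) x = 1 ↔ x ∈ bd K :=
  gauge_eq_one_iff_mem_frontier K.1.convex (body_mem_nhds K)

theorem gauge_body_pos (K : BodyO n) {x : Euc n} (hx : x ≠ 0) :
    0 < gauge (K.1 : Set (Euc n)) x :=
  (gauge_pos (absorbent_nhds_zero (body_mem_nhds K))
    ((NormedSpace.isVonNBounded_iff ℝ).2 K.1.isBounded)).2 hx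

theorem radial_eq_inv_gauge (K : BodyO n) {x : Euc n} (hx : x ≠ 0) :
    radial K x = (gauge (K.1 : Set (Euc n)) x)⁻¹ := by
  have hg := gauge_body_pos K hx
  have : {l : ℝ | 0 < l ∧ l • x ∈ (K.1 : Set (Euc n))} =
      Ioc 0 (gauge (K.1 : Set (Euc n)) x)⁻¹ := by
    ext l
    refine and_congr_right fun hl => ?_
    rw [← gauge_le_one_iff, gauge_smul_of_nonneg hl.le, smul_eq_mul, ← one_div, le_div_iff₀ hg]
  rw [radial, this, csSup_Ioc (inv_pos.2 hg)]

theorem sph_ne_zero (u : Sph n) : (u : Euc n) ≠ 0 := ne_zero_of_mem_unit_sphere u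

theorem radial_pos (K : BodyO n) (u : Sph n) : 0 < radial K u := by
  rw [radial_eq_inv_gauge K (sph_ne_zero u)]
  exact inv_pos.2 (gauge_body_pos K (sph_ne_zero u))

theorem continuous_radial (K : BodyO n) : Continuous fun u : Sph n => radial K u := by
  have h : (fun u : Sph n => radial K u) =
      fun u : Sph n => (gauge (K.1 : Set (Euc n)) (u : Euc n))⁻¹ :=
    funext fun u => radial_eq_inv_gauge K (sph_ne_zero u)
  rw [h]
  exact ((continuous_gauge K.1.convex (body_mem_nhds K)).comp continuous_subtype_val).inv₀
    fun u => (gauge_body_pos K (sph_ne_zero u)).ne'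

theorem smul_mem_iff_le_radial (K : BodyO n) (u : Sph n) {l : ℝ} (hl : 0 ≤ l) :
    l • (u : Euc n) ∈ (K.1 : Set (Euc n)) ↔ l ≤ radial K u := by
  rw [radial_eq_inv_gauge K (sph_ne_zero u), ← gauge_le_one_iff, gauge_smul_of_nonneg hl,
    smul_eq_mul, ← one_div, le_div_iff₀ (gauge_body_pos K (sph_ne_zero u))]

theorem radial_smul_mem_bd (K : BodyO n) (u : Sph n) : radial K u • (u : Euc n) ∈ bd K := by
  rw [← gauge_eq_one_iff, gauge_smul_of_nonneg (radial_pos K u).le,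
    radial_eq_inv_gauge K (sph_ne_zero u), smul_eq_mul,
    inv_mul_cancel₀ (gauge_body_pos K (sph_ne_zero u)).ne']

theorem radial_smul_mem (K : BodyO n) (u : Sph n) :
    radial K u • (u : Euc n) ∈ (K.1 : Set (Euc n)) := bd_subset K (radial_smul_mem_bd K u)

theorem ne_zero_of_mem_bd (K : BodyO n) {x : Euc n} (hx : x ∈ bd K) : x ≠ 0 := by
  rintro rfl
  exact hx.2 K.2

theorem radial_smul_of_mem_bd (K : BodyO n) {x : Euc n} (hx : x ∈ bd K) {u : Sph n}
    (hu : (u : Euc n) = ‖x‖⁻¹ • x) : radial K u • (u : Euc n) = x := by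
  have hx0 : 0 < ‖x‖ := norm_pos_iff.2 (ne_zero_of_mem_bd K hx)
  rw [radial_eq_inv_gauge K (sph_ne_zero u), hu, gauge_smul_of_nonneg (inv_pos.2 hx0).le,
    (gauge_eq_one_iff K x).2 hx, smul_smul]
  simp [hx0.ne']

theorem normalize_radial_smul (K : BodyO n) (u : Sph n) :
    (u : Euc n) = ‖radial K u • (u : Euc n)‖⁻¹ • (radial K u • (u : Euc n)) := by
  rw [norm_smul, norm_eq_of_mem_sphere, Real.norm_of_nonneg (radial_pos K u).le, mul_one,
    smul_smul, inv_mul_cancel₀ (radial_pos K u).ne', one_smul]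

theorem mem_radialNormals_iff (K : BodyO n) (u v : Sph n) :
    v ∈ radialNormals K {u} ↔ radial K u * ⟪(v : Euc n), (u : Euc n)⟫ = supp K v := by
  simp [radialNormals, normals, hyperplane, real_inner_smul_right]

theorem radialNormals_nonempty (K : BodyO n) (u : Sph n) : (radialNormals K {u}).Nonempty := by
  have := normals_nonempty K (radial_smul_mem_bd K u)
  simpa [radialNormals] using this

theorem mem_reverseRadial_iff (K : BodyO n) (A : Set (Sph n)) (u : Sph n) :
    u ∈ reverseRadial K A ↔ ∃ v ∈ A, v ∈ radialNormals K {u} := by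
  constructor
  · rintro ⟨x, ⟨hx, v, hv, hxv⟩, hu⟩
    refine ⟨v, hv, ?_⟩
    rw [mem_radialNormals_iff, ← real_inner_smul_right, radial_smul_of_mem_bd K hx hu]
    exact hxv
  · rintro ⟨v, hv, h⟩
    refine ⟨radial K u • (u : Euc n), ⟨radial_smul_mem_bd K u, v, hv, ?_⟩,
      normalize_radial_smul K u⟩
    rw [mem_radialNormals_iff, ← real_inner_smul_right] at h
    exact h

theorem inner_le_supp (K : BodyO n) (v : Euc n) {x : Euc n} (hx : x ∈ (K.1 : Set (Euc n))) :
    ⟪v, x⟫ ≤ supp K v :=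
  le_csSup (supp_bddAbove K v) (mem_image_of_mem _ hx)

theorem supp_le (K : BodyO n) (v : Euc n) {c : ℝ}
    (h : ∀ x ∈ (K.1 : Set (Euc n)), ⟪v, x⟫ ≤ c) : supp K v ≤ c := by
  refine csSup_le (K.1.nonempty.image _) ?_
  rintro _ ⟨x, hx, rfl⟩
  exact h x hx

/-- A body is the intersection of its supporting half-spaces. -/
theorem mem_of_forall_inner_le_supp (K : BodyO n) {x : Euc n}
    (h : ∀ v : Sph n, ⟪(v : Euc n), x⟫ ≤ supp K v) : x ∈ (K.1 : Set (Euc n)) := by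
  rcases eq_or_ne x 0 with rfl | hx
  · exact interior_subset K.2
  · set u : Sph n := ⟨‖x‖⁻¹ • x, by simp [norm_smul, hx]⟩ with hu
    have hx0 : 0 < ‖x‖ := norm_pos_iff.2 hx
    have hxu : x = ‖x‖ • (u : Euc n) := by
      rw [hu, smul_smul, mul_inv_cancel₀ hx0.ne', one_smul]
    obtain ⟨v, hv⟩ := radialNormals_nonempty K u
    rw [mem_radialNormals_iff] at hv
    rw [hxu, smul_mem_iff_le_radial K u hx0.le]
    have h1 := h v
    rw [hxu, real_inner_smul_right, ← hv] at h1
    refine le_of_mul_le_mul_right h1 ?_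
    -- The cancelled factor `⟨v, u⟩` must be positive: otherwise `h_K(v) ≤ 0`, although `ρ_K(v) v ∈
    -- K` gives `h_K(v) ≥ ρ_K(v) > 0`.
    by_contra! hneg
    have hle : supp K v ≤ 0 := by
      rw [← hv]
      exact mul_nonpos_of_nonneg_of_nonpos (radial_pos K u).le hneg
    have hrad := inner_le_supp K v (radial_smul_mem K v)
    rw [real_inner_smul_right, inner_self_sph, mul_one] at hrad
    linarith [radial_pos K v]

theorem radial_le_supp (K : BodyO n) (v : Sph n) : radial K v ≤ supp K v := by
  have h := inner_le_supp K v (radial_smul_mem K v)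
  rwa [real_inner_smul_right, inner_self_sph, mul_one] at h

theorem supp_pos (K : BodyO n) (v : Sph n) : 0 < supp K v :=
  (radial_pos K v).trans_le (radial_le_supp K v)

theorem inner_sph_le_one (u v : Sph n) : ⟪(u : Euc n), (v : Euc n)⟫ ≤ 1 := by
  simpa [norm_eq_of_mem_sphere] using real_inner_le_norm (u : Euc n) v

theorem inner_pos_of_mem_radialNormals (K : BodyO n) {u v : Sph n}
    (h : v ∈ radialNormals K {u}) : 0 < ⟪(v : Euc n), (u : Euc n)⟫ := by
  rw [mem_radialNormals_iff] at h
  exact pos_of_mul_pos_right (h ▸ supp_pos K v) (radial_pos K u).le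

/-- Two-sided bounds for the radial and the support function. -/
theorem exists_bounds (K : BodyO n) : ∃ r R : ℝ, 0 < r ∧ 0 < R ∧
    (∀ u : Sph n, r ≤ radial K u ∧ radial K u ≤ R) ∧
      ∀ u : Sph n, r ≤ supp K u ∧ supp K u ≤ R := by
  obtain ⟨r, hr, hrK⟩ := Metric.mem_nhds_iff.1 (body_mem_nhds K)
  obtain ⟨R, hR, hRK⟩ := K.1.isBounded.subset_closedBall_lt 0 (0 : Euc n)
  have h1 : ∀ u : Sph n, r / 2 ≤ radial K u := fun u => by
    rw [← smul_mem_iff_le_radial K u (by positivity)]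
    refine hrK ?_
    rw [mem_ball_zero_iff, norm_smul, norm_eq_of_mem_sphere, Real.norm_of_nonneg (by positivity)]
    linarith
  have h2 : ∀ u : Sph n, supp K u ≤ R := fun u => supp_le K u fun x hx => by
    refine (real_inner_le_norm _ _).trans ?_
    rw [norm_eq_of_mem_sphere, one_mul]
    exact mem_closedBall_zero_iff.1 (hRK hx)
  exact ⟨r / 2, R, by positivity, hR,
    fun u => ⟨h1 u, (radial_le_supp K u).trans (h2 u)⟩,
    fun u => ⟨(h1 u).trans (radial_le_supp K u), h2 u⟩⟩

theorem continuous_supp (K : BodyO n) : Continuous fun u : Sph n => supp K u := by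
  obtain ⟨R, hR, hRK⟩ := K.1.isBounded.subset_closedBall_lt 0 (0 : Euc n)
  refine (LipschitzWith.of_le_add_mul (⟨R, hR.le⟩ : NNReal) fun u v => ?_).continuous
  refine supp_le K u fun x hx => ?_
  have h1 : ⟪(u : Euc n), x⟫ = ⟪(v : Euc n), x⟫ + ⟪(u : Euc n) - v, x⟫ := by
    rw [inner_sub_left]
    ring
  have h2 : ⟪(u : Euc n) - v, x⟫ ≤ R * dist u v := by
    refine (real_inner_le_norm _ _).trans ?_
    rw [Subtype.dist_eq, dist_eq_norm, mul_comm]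
    exact mul_le_mul_of_nonneg_right (mem_closedBall_zero_iff.1 (hRK hx)) (norm_nonneg _)
  rw [h1]
  exact add_le_add (inner_le_supp K v hx) h2

/-! ### Almost everywhere uniqueness of the normal -/

/-- The point `w / gauge w` lies in `K`. This is the inequality half of the subgradient property of
`v / h_K(v)`. -/
theorem inner_le_supp_mul_gauge (K : BodyO n) (v : Sph n) (w : Euc n) :
    ⟪(v : Euc n), w⟫ ≤ supp K v * gauge (K.1 : Set (Euc n)) w := by
  rcases eq_or_ne w 0 with rfl | hw
  · simp
  · have hg := gauge_body_pos K hw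
    have hmem : (gauge (K.1 : Set (Euc n)) w)⁻¹ • w ∈ (K.1 : Set (Euc n)) := by
      rw [← gauge_le_one_iff, gauge_smul_of_nonneg (inv_pos.2 hg).le, smul_eq_mul,
        inv_mul_cancel₀ hg.ne']
    have h := inner_le_supp K v hmem
    rwa [real_inner_smul_right, ← div_eq_inv_mul, div_le_iff₀ hg] at h

/-- Normals are, up to scaling, subgradients of the gauge. -/
theorem gauge_eq_inner_of_mem_radialNormals (K : BodyO n) {u v : Sph n}
    (h : v ∈ radialNormals K {u}) {y : Euc n} (hy : y ≠ 0) (hu : (u : Euc n) = ‖y‖⁻¹ • y) :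
    supp K v * gauge (K.1 : Set (Euc n)) y = ⟪(v : Euc n), y⟫ := by
  have hy0 : 0 < ‖y‖ := norm_pos_iff.2 hy
  have hg := gauge_body_pos K hy
  rw [mem_radialNormals_iff, radial_eq_inv_gauge K (sph_ne_zero u), hu,
    gauge_smul_of_nonneg (inv_pos.2 hy0).le, real_inner_smul_right, smul_eq_mul] at h
  rw [← h]
  field_simp

/-- The derivative along `e^⊥` fixes the component of `v / h_K(v)` in `e^⊥`; the remaining component
along `e` is fixed by the value of the gauge at `e + z`, by homogeneity. -/
theorem radialNormals_subsingleton_of_differentiableAt (K : BodyO n) {e u : Sph n}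
    {z : (ℝ ∙ (e : Euc n))ᗮ} (hu : (u : Euc n) = ‖(e : Euc n) + z‖⁻¹ • ((e : Euc n) + z))
    (hd : DifferentiableAt ℝ
      (fun w : (ℝ ∙ (e : Euc n))ᗮ => gauge (K.1 : Set (Euc n)) ((e : Euc n) + w)) z) :
    (radialNormals K {u}).Subsingleton := by
  set f := fun w : (ℝ ∙ (e : Euc n))ᗮ => gauge (K.1 : Set (Euc n)) ((e : Euc n) + w) with hf
  have hy0 : (e : Euc n) + z ≠ 0 :=
    norm_pos_iff.1 (one_pos.trans_le (one_le_norm_add_orthogonal e z))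
  have key : ∀ v ∈ radialNormals K {u}, ∀ w : (ℝ ∙ (e : Euc n))ᗮ,
      fderiv ℝ f z w = ⟪(supp K v)⁻¹ • (v : Euc n), (w : Euc n)⟫ := by
    intro v hv w
    set p : Euc n := (supp K v)⁻¹ • (v : Euc n) with hp
    have hle : ∀ x, ⟪p, x⟫ ≤ gauge (K.1 : Set (Euc n)) x := fun x => by
      rw [hp, real_inner_smul_left, ← div_eq_inv_mul, div_le_iff₀' (supp_pos K v)]
      exact inner_le_supp_mul_gauge K v x
    have heq : ⟪p, (e : Euc n) + z⟫ = f z := by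
      rw [hp, real_inner_smul_left, ← gauge_eq_inner_of_mem_radialNormals K hv hy0 hu,
        inv_mul_cancel_left₀ (supp_pos K v).ne']
    have hlin : HasFDerivAt (fun w : (ℝ ∙ (e : Euc n))ᗮ => ⟪p, (e : Euc n) + w⟫)
        ((innerSL ℝ p).comp (ℝ ∙ (e : Euc n))ᗮ.subtypeL) z := by
      have := ((innerSL ℝ p).comp (ℝ ∙ (e : Euc n))ᗮ.subtypeL).hasFDerivAt (x := z)
      simpa [inner_add_right] using! this.const_add ⟪p, (e : Euc n)⟫
    -- The linear functional supports the gauge from below and touches it at `e + z`, so the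
    -- difference is minimal at `z` and its derivative vanishes there.
    have hmin : IsLocalMin (fun w : (ℝ ∙ (e : Euc n))ᗮ => f w - ⟪p, (e : Euc n) + w⟫) z := by
      refine Eventually.of_forall fun w => ?_
      change f z - ⟪p, (e : Euc n) + z⟫ ≤ f w - ⟪p, (e : Euc n) + w⟫
      rw [heq, sub_self, sub_nonneg]
      exact hle _
    have h0 := hmin.hasFDerivAt_eq_zero (hd.hasFDerivAt.sub hlin)
    have h1 := congrArg (fun g => g w) h0
    simpa [sub_eq_zero] using h1
  intro v hv v' hv'
  set q : Euc n := (supp K v)⁻¹ • (v : Euc n) - (supp K v')⁻¹ • (v' : Euc n) with hq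
  have hq1 : ∀ w : (ℝ ∙ (e : Euc n))ᗮ, ⟪q, (w : Euc n)⟫ = 0 := fun w => by
    rw [hq, inner_sub_left, ← key v hv w, ← key v' hv' w, sub_self]
  have hq2 : ⟪q, (e : Euc n) + z⟫ = 0 := by
    rw [hq, inner_sub_left, real_inner_smul_left, real_inner_smul_left,
      ← gauge_eq_inner_of_mem_radialNormals K hv hy0 hu,
      ← gauge_eq_inner_of_mem_radialNormals K hv' hy0 hu,
      inv_mul_cancel_left₀ (supp_pos K v).ne', inv_mul_cancel_left₀ (supp_pos K v').ne', sub_self]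
  -- As `q` is already orthogonal to `z`, being orthogonal to `e + z` makes it orthogonal to `e`; so
  -- `q` lies in `e^⊥` and is orthogonal to itself.
  have hq3 : ⟪(e : Euc n), q⟫ = 0 := by
    rw [inner_add_right, hq1 z, add_zero] at hq2
    rw [real_inner_comm, hq2]
  have hq4 : q = 0 := by
    have hmem : q ∈ (ℝ ∙ (e : Euc n))ᗮ :=
      Submodule.mem_orthogonal_singleton_iff_inner_right.2 hq3
    exact inner_self_eq_zero.1 (hq1 ⟨q, hmem⟩)
  have hq5 := sub_eq_zero.1 hq4
  -- Both normals are unit vectors, so comparing norms gives equal support values, and the common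
  -- scalar cancels.
  have hn := congrArg norm hq5
  rw [norm_smul, norm_smul, norm_eq_of_mem_sphere, norm_eq_of_mem_sphere, mul_one, mul_one,
    Real.norm_of_nonneg (inv_pos.2 (supp_pos K v)).le,
    Real.norm_of_nonneg (inv_pos.2 (supp_pos K v')).le] at hn
  rw [hn] at hq5
  exact Subtype.ext (smul_right_injective _ (inv_pos.2 (supp_pos K v')).ne' hq5)

/-- Almost every direction meets the boundary in a regular point. -/
theorem ae_existsUnique_radialNormals (K : BodyO n) :
    ∀ᵐ u ∂(μHE[n - 1] : Measure (Sph n)), ∃ v, radialNormals K {u} = {v} := by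
  rw [ae_iff]
  refine measure_null_of_locally_null _ fun e _ => ?_
  obtain ⟨C, hC⟩ := K.1.convex.lipschitz_gauge (body_mem_nhds K)
  have hlip : LipschitzWith C
      (fun w : (ℝ ∙ (e : Euc n))ᗮ => gauge (K.1 : Set (Euc n)) ((e : Euc n) + w)) := by
    refine LipschitzWith.of_dist_le_mul fun x y => ?_
    refine (hC.dist_le_mul _ _).trans_eq ?_
    simp [Subtype.dist_eq]
  -- Rademacher's theorem in the chart `e^⊥`, which covers the open hemisphere around `e`.
  have hae := hlip.ae_differentiableAt (μ := volume)
  refine ⟨{u | 0 < ⟪(e : Euc n), u⟫} ∩ {u | ¬ ∃ v, radialNormals K {u} = {v}}, ?_, ?_⟩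
  · refine inter_mem (mem_nhdsWithin_of_mem_nhds
      (IsOpen.mem_nhds (isOpen_lt (by fun_prop) (by fun_prop)) ?_)) self_mem_nhdsWithin
    change 0 < ⟪(e : Euc n), (e : Euc n)⟫
    rw [inner_self_sph]
    exact one_pos
  · have h := sphere_measure_le_volume e
      (A := {u | 0 < ⟪(e : Euc n), u⟫} ∩ {u | ¬ ∃ v, radialNormals K {u} = {v}})
      (T := {z | ¬ DifferentiableAt ℝ
        (fun w : (ℝ ∙ (e : Euc n))ᗮ => gauge (K.1 : Set (Euc n)) ((e : Euc n) + w)) z})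
      (fun u hu => by
        obtain ⟨z, -, hz⟩ := exists_orthogonal_eq_normalize e u hu.1
        refine ⟨z, fun hd => hu.2 ?_, hz⟩
        obtain ⟨v, hv⟩ := radialNormals_nonempty K u
        exact ⟨v, (radialNormals_subsingleton_of_differentiableAt K hz hd).eq_singleton_of_mem hv⟩)
    rw [ae_iff.1 hae, mul_zero] at h
    exact le_antisymm h zero_le

theorem radialNormals_eq_radialGauss {K : BodyO n} {u : Sph n}
    (h : ∃ v, radialNormals K {u} = {v}) : radialNormals K {u} = {radialGauss K u} := by
  rw [radialGauss, dif_pos h]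
  exact h.choose_spec

end Bodies

end DualOrlicz

namespace DualOrlicz

/-! ### Dependence on the body -/

section Limits

variable {n : ℕ}

theorem supp_le_supp_add_dist (K L : BodyO n) (v : Sph n) : supp L v ≤ supp K v + dist L K := by
  refine supp_le L v fun x hx => ?_
  refine le_of_forall_pos_le_add fun ε hε => ?_
  obtain ⟨y, hy, hxy⟩ := Metric.exists_dist_lt_of_hausdorffDist_lt hx
    (show Metric.hausdorffDist (L.1 : Set (Euc n)) K.1 < dist L K + ε by
      rw [ConvexBody.hausdorffDist_coe, ← Subtype.dist_eq]
      linarith) ConvexBody.hausdorffEDist_ne_top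
  have h1 : ⟪(v : Euc n), x⟫ = ⟪(v : Euc n), y⟫ + ⟪(v : Euc n), x - y⟫ := by
    rw [inner_sub_right]
    ring
  have h2 : ⟪(v : Euc n), x - y⟫ ≤ dist x y := by
    refine (real_inner_le_norm _ _).trans_eq ?_
    rw [norm_eq_of_mem_sphere, one_mul, dist_eq_norm]
  linarith [inner_le_supp K v hy]

/-- The hypothesis says that `L ⊆ c K`, since a body is cut out by its supporting half-spaces. -/
theorem radial_le_mul_radial {K L : BodyO n} {c : ℝ} (hc : 0 < c)
    (h : ∀ v : Sph n, supp L v ≤ c * supp K v) (u : Sph n) : radial L u ≤ c * radial K u := by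
  rw [← div_le_iff₀' hc, ← smul_mem_iff_le_radial K u (div_pos (radial_pos L u) hc).le]
  refine mem_of_forall_inner_le_supp K fun v => ?_
  rw [div_eq_inv_mul, mul_smul, real_inner_smul_right, ← div_eq_inv_mul, div_le_iff₀' hc]
  exact (inner_le_supp L v (radial_smul_mem L u)).trans (h v)

/-- The lower bound `r` turns the additive error `dist L K` into a multiplicative one, the form that
passes to radial functions. -/
theorem supp_le_mul_supp {K : BodyO n} {r : ℝ} (hr : 0 < r) (hK : ∀ v : Sph n, r ≤ supp K v)
    (L : BodyO n) (v : Sph n) : supp L v ≤ (1 + dist L K / r) * supp K v := by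
  have h1 := supp_le_supp_add_dist K L v
  have h2 : dist L K ≤ dist L K / r * supp K v := by
    rw [div_mul_eq_mul_div, le_div_iff₀ hr]
    exact mul_le_mul_of_nonneg_left (hK v) dist_nonneg
  linarith

theorem mul_supp_le_supp {K : BodyO n} {r : ℝ} (hr : 0 < r) (hK : ∀ v : Sph n, r ≤ supp K v)
    (L : BodyO n) (v : Sph n) : (1 - dist L K / r) * supp K v ≤ supp L v := by
  have h1 := supp_le_supp_add_dist L K v
  have h2 : dist L K ≤ dist L K / r * supp K v := by
    rw [div_mul_eq_mul_div, le_div_iff₀ hr]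
    exact mul_le_mul_of_nonneg_left (hK v) dist_nonneg
  rw [dist_comm] at h1
  linarith

theorem radial_le_one_add_mul_radial {K : BodyO n} {r : ℝ} (hr : 0 < r)
    (hK : ∀ v : Sph n, r ≤ supp K v) (L : BodyO n) (u : Sph n) :
    radial L u ≤ (1 + dist L K / r) * radial K u :=
  radial_le_mul_radial (by positivity) (supp_le_mul_supp hr hK L) u

theorem one_sub_mul_radial_le_radial {K : BodyO n} {r : ℝ} (hr : 0 < r)
    (hK : ∀ v : Sph n, r ≤ supp K v) (L : BodyO n) (u : Sph n) :
    (1 - dist L K / r) * radial K u ≤ radial L u := by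
  rcases le_or_gt (1 - dist L K / r) 0 with h | h
  · exact (mul_nonpos_of_nonpos_of_nonneg h (radial_pos K u).le).trans (radial_pos L u).le
  · rw [← le_div_iff₀' h, div_eq_inv_mul]
    refine radial_le_mul_radial (inv_pos.2 h) (fun v => ?_) u
    rw [← div_eq_inv_mul, le_div_iff₀' h]
    exact mul_supp_le_supp hr hK L v

variable {ι : Type*} {l : Filter ι} {K : BodyO n} {L : ι → BodyO n} {u : ι → Sph n} {u₀ : Sph n}

theorem tendsto_dist_div (hL : Tendsto L l (𝓝 K)) (r : ℝ) :
    Tendsto (fun i => dist (L i) K / r) l (𝓝 0) := by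
  simpa using (tendsto_iff_dist_tendsto_zero.1 hL).div_const r

/-- The multiplicative bounds are uniform in the direction, so body and direction may vary together.
-/
theorem tendsto_supp (hL : Tendsto L l (𝓝 K)) (hu : Tendsto u l (𝓝 u₀)) :
    Tendsto (fun i => supp (L i) (u i)) l (𝓝 (supp K u₀)) := by
  obtain ⟨r, R, hr, -, -, hs⟩ := exists_bounds K
  have hK := ((continuous_supp K).tendsto u₀).comp hu
  have hd := tendsto_dist_div hL r
  refine tendsto_of_tendsto_of_tendsto_of_le_of_le (g := fun i => (1 - dist (L i) K / r) *
    supp K (u i)) (h := fun i => (1 + dist (L i) K / r) * supp K (u i)) ?_ ?_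
    (fun i => mul_supp_le_supp hr (fun v => (hs v).1) (L i) (u i))
    (fun i => supp_le_mul_supp hr (fun v => (hs v).1) (L i) (u i))
  · simpa using (hd.const_sub 1).mul hK
  · simpa using (hd.const_add 1).mul hK

theorem tendsto_radial (hL : Tendsto L l (𝓝 K)) (hu : Tendsto u l (𝓝 u₀)) :
    Tendsto (fun i => radial (L i) (u i)) l (𝓝 (radial K u₀)) := by
  obtain ⟨r, R, hr, -, -, hs⟩ := exists_bounds K
  have hK := ((continuous_radial K).tendsto u₀).comp hu
  have hd := tendsto_dist_div hL r
  refine tendsto_of_tendsto_of_tendsto_of_le_of_le (g := fun i => (1 - dist (L i) K / r) *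
    radial K (u i)) (h := fun i => (1 + dist (L i) K / r) * radial K (u i)) ?_ ?_
    (fun i => one_sub_mul_radial_le_radial hr (fun v => (hs v).1) (L i) (u i))
    (fun i => radial_le_one_add_mul_radial hr (fun v => (hs v).1) (L i) (u i))
  · simpa using (hd.const_sub 1).mul hK
  · simpa using (hd.const_add 1).mul hK

/-- Two-sided bounds that hold for all bodies close to a given one. -/
theorem exists_eventually_bounds (K : BodyO n) : ∃ r R : ℝ, 0 < r ∧ ∀ᶠ L in 𝓝 K,
    (∀ u : Sph n, radial L u ∈ Icc r R) ∧ ∀ u : Sph n, supp L u ∈ Icc r R := by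
  obtain ⟨r, R, hr, hR, hrad, hs⟩ := exists_bounds K
  refine ⟨1 / 2 * r, 3 / 2 * R, by positivity, ?_⟩
  have hd := tendsto_dist_div (L := id) (l := 𝓝 K) tendsto_id r
  -- Once `dist L K ≤ r / 2`, the factors `1 ∓ dist L K / r` lie in `[1/2, 3/2]`.
  filter_upwards [hd.eventually_le_const (show (0 : ℝ) < 1 / 2 by norm_num)] with L hL
  have hL' : dist L K / r ≤ 1 / 2 := hL
  have hL0 : 0 ≤ dist L K / r := by positivity
  have aux : ∀ a b : ℝ, r ≤ a → a ≤ R → (1 - dist L K / r) * a ≤ b → b ≤ (1 + dist L K / r) * a →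
      b ∈ Icc (1 / 2 * r) (3 / 2 * R) := fun a b h1 h2 h3 h4 =>
    ⟨(mul_le_mul (by linarith) h1 hr.le (by linarith)).trans h3,
      h4.trans (mul_le_mul (by linarith) h2 (hr.le.trans h1) (by norm_num))⟩
  exact ⟨fun u => aux _ _ (hrad u).1 (hrad u).2
      (one_sub_mul_radial_le_radial hr (fun v => (hs v).1) L u)
      (radial_le_one_add_mul_radial hr (fun v => (hs v).1) L u),
    fun u => aux _ _ (hs u).1 (hs u).2
      (mul_supp_le_supp hr (fun v => (hs v).1) L u)
      (supp_le_mul_supp hr (fun v => (hs v).1) L u)⟩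

/-- Normals of converging bodies converge to the normal at a regular point of the limit. -/
theorem tendsto_of_mem_radialNormals (hL : Tendsto L l (𝓝 K)) (hu : Tendsto u l (𝓝 u₀))
    {v : ι → Sph n} (hv : ∀ᶠ i in l, v i ∈ radialNormals (L i) {u i})
    (h₀ : ∃ w, radialNormals K {u₀} = {w}) :
    Tendsto v l (𝓝 (radialGauss K u₀)) := by
  -- The sphere is compact, so it is enough that every cluster point `w` is a normal of `K` at `u₀`;
  -- this follows by passing to the limit in `ρ(u)⟨v, u⟩ = h(v)` along an ultrafilter.
  refine isCompact_univ.tendsto_nhds_of_unique_mapClusterPt (Eventually.of_forall fun _ => mem_univ _)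
    fun w _ hw => ?_
  obtain ⟨U, hUl, hU⟩ := mapClusterPt_iff_ultrafilter.1 hw
  have hL' := hL.mono_left hUl
  have hu' := hu.mono_left hUl
  have h1 : Tendsto (fun i => radial (L i) (u i) * ⟪(v i : Euc n), (u i : Euc n)⟫) U
      (𝓝 (radial K u₀ * ⟪(w : Euc n), (u₀ : Euc n)⟫)) :=
    (tendsto_radial hL' hu').mul
      (((continuous_subtype_val.tendsto w).comp hU).inner ((continuous_subtype_val.tendsto u₀).comp hu'))
  have h2 := tendsto_supp hL' hU
  have h3 : radial K u₀ * ⟪(w : Euc n), (u₀ : Euc n)⟫ = supp K w := by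
    refine tendsto_nhds_unique h1 (h2.congr' ?_)
    filter_upwards [hUl hv] with i hi
    exact ((mem_radialNormals_iff _ _ _).1 hi).symm
  have h4 : w ∈ radialNormals K {u₀} := (mem_radialNormals_iff _ _ _).2 h3
  rwa [radialNormals_eq_radialGauss h₀] at h4

theorem radialGauss_mem_radialNormals {K : BodyO n} {u : Sph n}
    (h : ∃ v, radialNormals K {u} = {v}) : radialGauss K u ∈ radialNormals K {u} := by
  rw [radialNormals_eq_radialGauss h]
  exact mem_singleton _

/-- On a measurable conull set where the normal is unique, `α_K` is continuous: this is the
convergence of normals for a constant family of bodies. -/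
theorem aemeasurable_radialGauss (K : BodyO n) :
    AEMeasurable (radialGauss K) (μHE[n - 1] : Measure (Sph n)) := by
  set N : Set (Sph n) := {u | ¬ ∃ v, radialNormals K {u} = {v}} with hN
  have hN0 : (μHE[n - 1] : Measure (Sph n)) N = 0 := ae_iff.1 (ae_existsUnique_radialNormals K)
  set M := (toMeasurable (μHE[n - 1] : Measure (Sph n)) N)ᶜ with hM
  have hMN : ∀ u ∈ M, ∃ v, radialNormals K {u} = {v} := fun u hu => by
    by_contra h
    exact hu (subset_toMeasurable _ _ h)
  have hc : ContinuousOn (radialGauss K) M := fun u hu =>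
    tendsto_of_mem_radialNormals (L := fun _ => K) tendsto_const_nhds
      (tendsto_id.mono_left nhdsWithin_le_nhds)
      (eventually_mem_nhdsWithin.mono fun w hw => radialGauss_mem_radialNormals (hMN w hw))
      (hMN u hu)
  have hres : (μHE[n - 1] : Measure (Sph n)).restrict M = μHE[n - 1] := by
    refine Measure.restrict_eq_self_of_ae_mem ?_
    rw [ae_iff]
    simpa [hM] using hN0
  rw [← hres]
  exact hc.aemeasurable (measurableSet_toMeasurable _ _).compl

/-- Replaces the set-valued map by a preimage, which makes the curvature measure a push-forward. -/
theorem reverseRadial_ae_eq (K : BodyO n) (A : Set (Sph n)) :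
    reverseRadial K A =ᵐ[(μHE[n - 1] : Measure (Sph n))] radialGauss K ⁻¹' A := by
  filter_upwards [ae_existsUnique_radialNormals K] with u hu
  refine propext ?_
  change u ∈ reverseRadial K A ↔ radialGauss K u ∈ A
  rw [mem_reverseRadial_iff, radialNormals_eq_radialGauss hu]
  simp

/-! ### The density -/

variable {G : ℝ → Sph n → ℝ} {ψ : ℝ → ℝ}

theorem aemeasurable_density
    (hGt : ContinuousOn (fun p : ℝ × Sph n => deriv (fun s => G s p.2) p.1) (Ioi 0 ×ˢ univ))
    (hψ : ContinuousOn ψ (Ioi 0)) (K : BodyO n) :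
    AEMeasurable (density G ψ K) (μHE[n - 1] : Measure (Sph n)) := by
  have h1 : Continuous fun u : Sph n => deriv (fun t => G t u) (radial K u) :=
    hGt.comp_continuous ((continuous_radial K).prodMk continuous_id)
      fun u => ⟨radial_pos K u, mem_univ _⟩
  have h2 : Continuous fun u : Sph n => ψ (supp K u) :=
    hψ.comp_continuous (continuous_supp K) fun u => supp_pos K u
  exact ((continuous_radial K).mul h1).aemeasurable.div
    (h2.measurable.comp_aemeasurable (aemeasurable_radialGauss K))

theorem tendsto_density {L : ι → BodyO n}
    (hGt : ContinuousOn (fun p : ℝ × Sph n => deriv (fun s => G s p.2) p.1) (Ioi 0 ×ˢ univ))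
    (hψ : ContinuousOn ψ (Ioi 0)) (hψpos : ∀ t : ℝ, 0 < t → 0 < ψ t)
    (hL : Tendsto L l (𝓝 K)) {u : Sph n}
    (hα : Tendsto (fun i => radialGauss (L i) u) l (𝓝 (radialGauss K u))) :
    Tendsto (fun i => density G ψ (L i) u) l (𝓝 (density G ψ K u)) := by
  have hρ := tendsto_radial hL (tendsto_const_nhds (x := u))
  have h1 : Tendsto (fun i => deriv (fun t => G t u) (radial (L i) u)) l
      (𝓝 (deriv (fun t => G t u) (radial K u))) := by
    have hc : ContinuousAt (fun p : ℝ × Sph n => deriv (fun s => G s p.2) p.1) (radial K u, u) :=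
      hGt.continuousAt (prod_mem_nhds (Ioi_mem_nhds (radial_pos K u)) univ_mem)
    exact hc.tendsto.comp (hρ.prodMk_nhds tendsto_const_nhds)
  have h2 := (hψ.continuousAt (Ioi_mem_nhds (supp_pos K (radialGauss K u)))).tendsto.comp
    (tendsto_supp hL hα)
  exact (hρ.mul h1).div h2 (hψpos _ (supp_pos K _)).ne'

/-- By compactness of `[r, R]` and of the sphere, the bound depends on the body only through `r` and
`R`; it supplies the dominating constant for all bodies near `K`. -/
theorem exists_density_bound
    (hGt : ContinuousOn (fun p : ℝ × Sph n => deriv (fun s => G s p.2) p.1) (Ioi 0 ×ˢ univ))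
    (hψ : ContinuousOn ψ (Ioi 0)) (hψpos : ∀ t : ℝ, 0 < t → 0 < ψ t) {r : ℝ} (hr : 0 < r) (R : ℝ) :
    ∃ C, ∀ L : BodyO n, (∀ u : Sph n, radial L u ∈ Icc r R) → (∀ u : Sph n, supp L u ∈ Icc r R) →
      ∀ u, ‖density G ψ L u‖ ≤ C := by
  have hsub : Icc r R ⊆ Ioi 0 := fun t ht => hr.trans_le ht.1
  obtain ⟨M, hM⟩ := (isCompact_Icc.prod isCompact_univ).exists_bound_of_continuousOn
    (hGt.mono (prod_mono_left hsub))
  obtain ⟨P, hP⟩ := isCompact_Icc.exists_bound_of_continuousOn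
    ((hψ.mono hsub).inv₀ fun t ht => (hψpos t (hsub ht)).ne')
  refine ⟨R * M * P, fun L hrad hs u => ?_⟩
  have h1 := hM (radial L u, u) ⟨hrad u, mem_univ _⟩
  have h2 := hP _ (hs (radialGauss L u))
  have h3 : ‖radial L u‖ ≤ R := by
    rw [Real.norm_of_nonneg (radial_pos L u).le]
    exact (hrad u).2
  rw [density, div_eq_mul_inv, norm_mul, norm_mul]
  have h4 : 0 ≤ R := (norm_nonneg _).trans h3
  have h5 : 0 ≤ M := (norm_nonneg _).trans h1
  gcongr
  exact h2

theorem integrable_density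
    (hGt : ContinuousOn (fun p : ℝ × Sph n => deriv (fun s => G s p.2) p.1) (Ioi 0 ×ˢ univ))
    (hψ : ContinuousOn ψ (Ioi 0)) (hψpos : ∀ t : ℝ, 0 < t → 0 < ψ t) (K : BodyO n) :
    Integrable (density G ψ K) (μHE[n - 1] : Measure (Sph n)) := by
  obtain ⟨r, R, hr, h⟩ := exists_eventually_bounds K
  obtain ⟨C, hC⟩ := exists_density_bound hGt hψ hψpos hr R
  exact Integrable.of_bound (aemeasurable_density hGt hψ K).aestronglyMeasurable C
    (Eventually.of_forall (hC K h.self_of_nhds.1 h.self_of_nhds.2))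

end Limits

end DualOrlicz

namespace DualOrlicz

/-! ### Images of measures with densities -/

/-- Only the positive part of `f` is pushed forward; applying this to `f` and to `-f` yields the
signed version. -/
theorem exists_map_withDensity {X Y : Type*} [MeasurableSpace X] [TopologicalSpace Y]
    [CompactSpace Y] [SecondCountableTopology Y] [MeasurableSpace Y] [BorelSpace Y] {σ : Measure X}
    {a : X → Y} (ha : AEMeasurable a σ) {f : X → ℝ} (hf : Integrable f σ) :
    ∃ μ : FiniteMeasure Y,
      (∀ A, MeasurableSet A → (μ : Measure Y).real A = ∫ x, (a ⁻¹' A).indicator 1 x * max (f x) 0 ∂σ) ∧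
      ∀ g : Y → ℝ, Continuous g → Integrable g (μ : Measure Y) ∧
        ∫ y, g y ∂(μ : Measure Y) = ∫ x, g (a x) * max (f x) 0 ∂σ := by
  have hfin : IsFiniteMeasure (σ.withDensity fun x => ENNReal.ofReal (f x)) :=
    isFiniteMeasure_withDensity_ofReal hf.2
  have ha' : AEMeasurable a (σ.withDensity fun x => ENNReal.ofReal (f x)) :=
    ha.mono_ac (withDensity_absolutelyContinuous _ _)
  have hint : ∀ g : Y → ℝ, Measurable g →
      ∫ y, g y ∂((σ.withDensity fun x => ENNReal.ofReal (f x)).map a) =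
        ∫ x, g (a x) * max (f x) 0 ∂σ := fun g hg => by
    rw [integral_map ha' hg.aestronglyMeasurable, integral_withDensity_eq_integral_toReal_smul₀
      hf.aemeasurable.ennreal_ofReal (Eventually.of_forall fun _ => ENNReal.ofReal_lt_top)]
    refine integral_congr_ae (Eventually.of_forall fun x => ?_)
    simp only [ENNReal.toReal_ofReal', smul_eq_mul, mul_comm]
  refine ⟨⟨(σ.withDensity fun x => ENNReal.ofReal (f x)).map a, inferInstance⟩, fun A hA => ?_,
    fun g hg => ⟨?_, hint g hg.measurable⟩⟩
  · have h := hint (A.indicator 1) (measurable_one.indicator hA)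
    rw [integral_indicator_one hA] at h
    exact h
  · obtain ⟨C, hC⟩ := isCompact_univ.exists_bound_of_continuousOn hg.continuousOn
    change Integrable g ((σ.withDensity fun x => ENNReal.ofReal (f x)).map a)
    exact Integrable.of_bound hg.measurable.aestronglyMeasurable C
      (Eventually.of_forall fun y => hC y (mem_univ y))

theorem integral_smul_toSignedMeasure {Y : Type*} [MeasurableSpace Y] (μ : Measure Y)
    [IsFiniteMeasure μ] (g : Y → ℝ) : ∫ᵛ y, g y ∂•μ.toSignedMeasure = ∫ y, g y ∂μ := by
  -- Real multiplication is commutative, so the pairing equals its flip.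
  have h : ContinuousLinearMap.lsmul ℝ ℝ (E := ℝ) = (ContinuousLinearMap.lsmul ℝ ℝ).flip := by
    ext
    simp
  rw [h, VectorMeasure.integral_toSignedMeasure]

theorem exists_signedMeasure_map {X Y : Type*} [MeasurableSpace X] [TopologicalSpace Y]
    [CompactSpace Y] [SecondCountableTopology Y] [MeasurableSpace Y] [BorelSpace Y] {σ : Measure X}
    {a : X → Y} (ha : AEMeasurable a σ) {f : X → ℝ} (hf : Integrable f σ) :
    ∃ C : SignedMeasure Y, (∀ A, MeasurableSet A → C A = ∫ x in a ⁻¹' A, f x ∂σ) ∧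
      ∀ g : Y → ℝ, Continuous g → ∫ᵛ y, g y ∂•C = ∫ x, g (a x) * f x ∂σ := by
  obtain ⟨μ, hμ, hμi⟩ := exists_map_withDensity ha hf
  obtain ⟨ν, hν, hνi⟩ := exists_map_withDensity ha hf.neg
  have hsub : ∀ x, max (f x) 0 - max ((-f) x) 0 = f x := fun x => by
    exact max_zero_sub_max_neg_zero_eq_self (f x)
  have hsplit : ∀ φ : X → ℝ, AEStronglyMeasurable φ σ → (∃ C, ∀ x, ‖φ x‖ ≤ C) →
      (∫ x, φ x * max (f x) 0 ∂σ) - ∫ x, φ x * max ((-f) x) 0 ∂σ = ∫ x, φ x * f x ∂σ := by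
    rintro φ hφ ⟨C, hC⟩
    rw [← integral_sub (hf.pos_part.bdd_mul hφ (Eventually.of_forall hC))
      (hf.neg.pos_part.bdd_mul hφ (Eventually.of_forall hC))]
    refine integral_congr_ae (Eventually.of_forall fun x => ?_)
    simp only [← mul_sub, hsub]
  refine ⟨(μ : Measure Y).toSignedMeasure - (ν : Measure Y).toSignedMeasure, fun A hA => ?_,
    fun g hg => ?_⟩
  · have hm : NullMeasurableSet (a ⁻¹' A) σ := ha.nullMeasurableSet_preimage hA
    rw [_root_.sub_apply, Measure.toSignedMeasure_apply_measurable hA,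
      Measure.toSignedMeasure_apply_measurable hA, hμ A hA, hν A hA, hsplit]
    · rw [← integral_indicator₀ hm]
      refine integral_congr_ae (Eventually.of_forall fun x => ?_)
      by_cases hx : x ∈ a ⁻¹' A <;> simp [hx]
    · exact (aestronglyMeasurable_const (b := (1 : ℝ))).indicator₀ hm
    · refine ⟨1, fun x => ?_⟩
      by_cases hx : x ∈ a ⁻¹' A <;> simp [hx]
  · rw [VectorMeasure.integral_sub_vectorMeasure, integral_smul_toSignedMeasure,
      integral_smul_toSignedMeasure, (hμi g hg).2, (hνi g hg).2, hsplit]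
    · exact (hg.measurable.comp_aemeasurable ha).aestronglyMeasurable
    · obtain ⟨C, hC⟩ := isCompact_univ.exists_bound_of_continuousOn hg.continuousOn
      exact ⟨C, fun x => hC _ (mem_univ _)⟩
    · simpa [VectorMeasure.Integrable] using (hμi g hg).1
    · simpa [VectorMeasure.Integrable] using (hνi g hg).1

/-! ### The curvature measure -/

section Curvature

variable {n : ℕ} {G : ℝ → Sph n → ℝ} {ψ : ℝ → ℝ}

theorem curvatureValue_eq (K : BodyO n) (A : Set (Sph n)) :
    curvatureValue G ψ K A = ∫ u in radialGauss K ⁻¹' A, 1 / (n : ℝ) * density G ψ K u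
      ∂(μHE[n - 1] : Measure (Sph n)) := by
  rw [curvatureValue, setIntegral_congr_set (reverseRadial_ae_eq K A), integral_const_mul]

/-- The push-forward shows that a signed measure with the prescribed values exists. Since values on
Borel sets determine it, the chosen one is that push-forward and inherits its integral formula. -/
theorem curvatureMeasure_spec {K : BodyO n}
    (hint : Integrable (density G ψ K) (μHE[n - 1] : Measure (Sph n))) :
    (∀ A, MeasurableSet A → curvatureMeasure G ψ K A = curvatureValue G ψ K A) ∧
      ∀ g : Sph n → ℝ, Continuous g → ∫ᵛ u, g u ∂•(curvatureMeasure G ψ K) =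
        ∫ u, g (radialGauss K u) * (1 / (n : ℝ) * density G ψ K u)
          ∂(μHE[n - 1] : Measure (Sph n)) := by
  obtain ⟨C, hC, hCi⟩ := exists_signedMeasure_map (aemeasurable_radialGauss K)
    (hint.const_mul (1 / (n : ℝ)))
  have hex : ∃ C : SignedMeasure (Sph n), ∀ A, MeasurableSet A → C A = curvatureValue G ψ K A :=
    ⟨C, fun A hA => by rw [hC A hA, curvatureValue_eq]⟩
  have hval : ∀ A, MeasurableSet A → curvatureMeasure G ψ K A = curvatureValue G ψ K A := by
    rw [curvatureMeasure, dif_pos hex]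
    exact hex.choose_spec
  have heq : curvatureMeasure G ψ K = C :=
    VectorMeasure.ext fun A hA => by rw [hval A hA, hC A hA, curvatureValue_eq]
  exact ⟨hval, fun g hg => by rw [heq, hCi g hg]⟩

theorem reverseRadial_null_of_surfaceArea_null (K : BodyO n) {A : Set (Sph n)}
    (hA : MeasurableSet A) (h : surfaceArea K A = 0) :
    (μHE[n - 1] : Measure (Sph n)) (reverseRadial K A) = 0 := by
  rw [measure_congr (reverseRadial_ae_eq K A)]
  set R : Set (Sph n) := {u | ∃ v, radialNormals K {u} = {v}} with hR
  have hR0 : (μHE[n - 1] : Measure (Sph n)) Rᶜ = 0 := ae_iff.1 (ae_existsUnique_radialNormals K)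
  obtain ⟨r, R', hr, -, hrad, -⟩ := exists_bounds K
  rw [surfaceArea_apply K hA] at h
  -- Directions with a non-unique normal are null; the others come from regular points with Gauss
  -- image in `A`, and these points have norm at least `r`.
  refine measure_mono_null (t := radialGauss K ⁻¹' A ∩ R ∪ Rᶜ) (fun u hu => ?_)
    (measure_union_null ?_ hR0)
  · by_cases hu' : u ∈ R
    · exact Or.inl ⟨hu, hu'⟩
    · exact Or.inr hu'
  · refine sphere_measure_eq_zero_of_normalize (r := ⟨r, hr.le⟩) hr ?_ ?_ h
    · rintro x ⟨hx, -⟩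
      have hx0 : x ≠ 0 := ne_zero_of_mem_bd K hx.1
      have h1 := radial_smul_of_mem_bd K hx.1 (u := ⟨‖x‖⁻¹ • x, by simp [norm_smul, hx0]⟩) rfl
      have h2 := congrArg norm h1
      rw [norm_smul, norm_eq_of_mem_sphere, mul_one, Real.norm_of_nonneg (radial_pos K _).le] at h2
      rw [← h2]
      exact (hrad _).1
    · rintro u ⟨huA, huR⟩
      have hN : normals K {radial K u • (u : Euc n)} = {radialGauss K u} := by
        have := radialNormals_eq_radialGauss huR
        rwa [radialNormals, image_singleton] at this
      have hreg : radial K u • (u : Euc n) ∈ reg K := by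
        refine ⟨radial_smul_mem_bd K u, fun hs => ?_⟩
        have := hs.2
        rw [hN] at this
        exact not_nontrivial_singleton this
      refine ⟨_, ⟨hreg, ?_⟩, normalize_radial_smul K u⟩
      have := gauss_spec K ⟨_, hreg⟩
      rw [hN, singleton_eq_singleton_iff] at this
      rw [← this]
      exact huA

theorem weakConv_curvatureMeasure
    (hGt : ContinuousOn (fun p : ℝ × Sph n => deriv (fun s => G s p.2) p.1) (Ioi 0 ×ˢ univ))
    (hψ : ContinuousOn ψ (Ioi 0)) (hψpos : ∀ t : ℝ, 0 < t → 0 < ψ t) {K : BodyO n}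
    {L : ℕ → BodyO n} (hL : Tendsto L atTop (𝓝 K)) :
    WeakConv (fun i => curvatureMeasure G ψ (L i)) (curvatureMeasure G ψ K) := by
  intro g hg
  have hint := integrable_density (G := G) hGt hψ hψpos
  simp only [(curvatureMeasure_spec (hint _)).2 g hg]
  obtain ⟨r, R, hr, hb⟩ := exists_eventually_bounds K
  obtain ⟨C, hC⟩ := exists_density_bound hGt hψ hψpos hr R
  obtain ⟨M, hM⟩ := isCompact_univ.exists_bound_of_continuousOn hg.continuousOn
  refine tendsto_integral_filter_of_dominated_convergence
    (fun _ => M * (‖1 / (n : ℝ)‖ * C)) ?_ ?_ (integrable_const _) ?_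
  · refine Eventually.of_forall fun i => ?_
    exact ((hg.measurable.comp_aemeasurable (aemeasurable_radialGauss (L i))).mul
      ((aemeasurable_density hGt hψ (L i)).const_mul _)).aestronglyMeasurable
  · filter_upwards [hL.eventually hb] with i hi
    refine Eventually.of_forall fun u => ?_
    have h1 := hM (radialGauss (L i) u) (mem_univ _)
    have h2 := hC (L i) hi.1 hi.2 u
    rw [norm_mul, norm_mul]
    have h3 : 0 ≤ M := (norm_nonneg _).trans h1
    gcongr
  -- Countably many bodies are involved, so almost every `u` has a unique normal for all of them at
  -- once.
  · filter_upwards [ae_existsUnique_radialNormals K,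
      ae_all_iff.2 fun i => ae_existsUnique_radialNormals (L i)] with u hu hui
    have hα : Tendsto (fun i => radialGauss (L i) u) atTop (𝓝 (radialGauss K u)) :=
      tendsto_of_mem_radialNormals hL tendsto_const_nhds
        (Eventually.of_forall fun i => radialGauss_mem_radialNormals (hui i)) hu
    exact ((hg.tendsto _).comp hα).mul ((tendsto_density hGt hψ hψpos hL hα).const_mul _)

/-- For `w = α_K(u)`, `r ≤ h_K(w) = ρ_K(u)⟨w, u⟩ ≤ R⟨w, u⟩`; replacing `u` by `v` costs at most
`dist u v < r / R`. -/
theorem inner_radialGauss_pos {K : BodyO n} {r R : ℝ} (hR : 0 < R)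
    (hrad : ∀ u : Sph n, radial K u ≤ R) (hs : ∀ u : Sph n, r ≤ supp K u) {u v : Sph n}
    (hu : ∃ w, radialNormals K {u} = {w}) (huv : dist u v < r / R) :
    0 < ⟪(radialGauss K u : Euc n), (v : Euc n)⟫ := by
  have hmem := radialGauss_mem_radialNormals hu
  set w := radialGauss K u
  have hin := inner_pos_of_mem_radialNormals K hmem
  rw [mem_radialNormals_iff] at hmem
  have h1 : r / R ≤ ⟪(w : Euc n), (u : Euc n)⟫ := by
    rw [div_le_iff₀' hR]
    refine (hs w).trans (hmem.symm.le.trans ?_)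
    exact mul_le_mul_of_nonneg_right (hrad u) hin.le
  have h2 : ⟪(w : Euc n), (u : Euc n) - v⟫ ≤ dist u v := by
    refine (real_inner_le_norm _ _).trans_eq ?_
    rw [norm_eq_of_mem_sphere, one_mul, Subtype.dist_eq, dist_eq_norm]
  rw [inner_sub_right] at h2
  linarith

/-- The image of a measure with positive density under the radial Gauss map is not concentrated on
a closed hemisphere. -/
theorem exists_finiteMeasure_of_pos (hn : 1 ≤ n) (K : BodyO n) {f : Sph n → ℝ}
    (hf : Integrable f (μHE[n - 1] : Measure (Sph n))) (hpos : ∀ u, 0 < f u)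
    {C : SignedMeasure (Sph n)} (hC : ∀ A, MeasurableSet A →
      C A = ∫ u in radialGauss K ⁻¹' A, f u ∂(μHE[n - 1] : Measure (Sph n))) :
    ∃ μ : FiniteMeasure (Sph n), (μ : Measure (Sph n)).toSignedMeasure = C ∧
      μ ≠ 0 ∧ NotInClosedHemisphere (μ : Measure (Sph n)) := by
  have ha := aemeasurable_radialGauss K
  obtain ⟨μ, hμ, hμi⟩ := exists_map_withDensity ha hf
  have hmax : ∀ u, max (f u) 0 = f u := fun u => max_eq_left (hpos u).le
  simp only [hmax] at hμ hμi
  have hhemi : NotInClosedHemisphere (μ : Measure (Sph n)) := by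
    intro v
    have hg : Continuous fun u : Sph n => max ⟪(u : Euc n), (v : Euc n)⟫ 0 := by fun_prop
    rw [(hμi _ hg).2]
    obtain ⟨r, R, hr, hR, hrad, hs⟩ := exists_bounds K
    refine (integral_pos_iff_support_of_nonneg_ae (Eventually.of_forall fun u =>
      mul_nonneg (le_max_right _ _) (hpos u).le) ?_).2 ?_
    · refine hf.bdd_mul (c := 1) (hg.measurable.comp_aemeasurable ha).aestronglyMeasurable
        (Eventually.of_forall fun u => ?_)
      rw [Real.norm_of_nonneg (le_max_right _ _)]
      exact max_le (inner_sph_le_one _ _) zero_le_one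
    -- Almost all of the ball of radius `r / R` around `v` lies in the support of the integrand.
    · refine (sphere_measure_ball_pos v (div_pos hr hR)).trans_le (measure_mono_ae ?_)
      filter_upwards [ae_existsUnique_radialNormals K] with u hu hball
      have h := inner_radialGauss_pos hR (fun u => (hrad u).2) (fun u => (hs u).1) hu hball
      exact (mul_pos (lt_max_of_lt_left h) (hpos u)).ne'
  refine ⟨μ, VectorMeasure.ext fun A hA => ?_, ?_, hhemi⟩
  · rw [Measure.toSignedMeasure_apply_measurable hA, hμ A hA, hC A hA,
      ← integral_indicator₀ (ha.nullMeasurableSet_preimage hA)]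
    refine integral_congr_ae (Eventually.of_forall fun x => ?_)
    by_cases hx : x ∈ radialGauss K ⁻¹' A <;> simp [hx]
  -- Since `n ≥ 1` a unit vector exists, and the hemisphere condition at it fails for the zero
  -- measure.
  · rintro rfl
    have h := hhemi ⟨EuclideanSpace.single ⟨0, hn⟩ 1, by simp⟩
    simp at h

end Curvature

end DualOrlicz

theorem mainTheorem9 (n : ℕ) (hn : 1 ≤ n) (G : ℝ → Sph n → ℝ) (ψ : ℝ → ℝ)
    (hG : ContinuousOn (fun p : ℝ × Sph n => G p.1 p.2) (Ioi 0 ×ˢ univ))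
    (hGd : ∀ t : ℝ, 0 < t → ∀ u : Sph n, DifferentiableAt ℝ (fun s => G s u) t)
    (hGt : ContinuousOn (fun p : ℝ × Sph n => deriv (fun s => G s p.2) p.1) (Ioi 0 ×ˢ univ))
    (hψ : ContinuousOn ψ (Ioi 0)) (hψpos : ∀ t : ℝ, 0 < t → 0 < ψ t)
    (K : BodyO n) :
    -- the curvature measure is well defined by its integral formula
    (Integrable (density G ψ K) (μHE[n - 1] : Measure (Sph n)) ∧
      ∀ A : Set (Sph n), MeasurableSet A →
        NullMeasurableSet (reverseRadial K A) (μHE[n - 1] : Measure (Sph n)) ∧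
        curvatureMeasure G ψ K A = curvatureValue G ψ K A) ∧
    -- (i) absolute continuity with respect to the surface area measure
    (curvatureMeasure G ψ K ≪ᵥ (surfaceArea K).toENNRealVectorMeasure) ∧
    -- (ii) weak continuity with respect to Hausdorff convergence
    (∀ L : ℕ → BodyO n, Tendsto L atTop (𝓝 K) →
      WeakConv (fun i => curvatureMeasure G ψ (L i)) (curvatureMeasure G ψ K)) ∧
    -- (iii) constant sign of `G_t`
    ((∀ t : ℝ, 0 < t → ∀ u : Sph n, 0 < deriv (fun s => G s u) t) →
      ∃ μ : FiniteMeasure (Sph n), (μ : Measure (Sph n)).toSignedMeasure = curvatureMeasure G ψ K ∧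
        μ ≠ 0 ∧ NotInClosedHemisphere (μ : Measure (Sph n))) ∧
    ((∀ t : ℝ, 0 < t → ∀ u : Sph n, deriv (fun s => G s u) t < 0) →
      ∃ μ : FiniteMeasure (Sph n), (μ : Measure (Sph n)).toSignedMeasure = -curvatureMeasure G ψ K ∧
        μ ≠ 0 ∧ NotInClosedHemisphere (μ : Measure (Sph n))) := by
  have hint := integrable_density hGt hψ hψpos K
  have hspec := (curvatureMeasure_spec hint).1
  have hn0 : (0 : ℝ) < 1 / n := by positivity
  refine ⟨⟨hint, fun A hA => ⟨?_, hspec A hA⟩⟩, ?_, ?_, fun hpos => ?_, fun hneg => ?_⟩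
  · exact ((aemeasurable_radialGauss K).nullMeasurableSet_preimage hA).congr
      (reverseRadial_ae_eq K A).symm
  · refine VectorMeasure.AbsolutelyContinuous.mk fun A hA h => ?_
    rw [Measure.toENNRealVectorMeasure_apply_measurable hA] at h
    rw [hspec A hA, curvatureValue,
      setIntegral_measure_zero _ (reverseRadial_null_of_surfaceArea_null K hA h), mul_zero]
  · exact fun L hL => weakConv_curvatureMeasure hGt hψ hψpos hL
  · refine exists_finiteMeasure_of_pos hn K (hint.const_mul (1 / (n : ℝ))) (fun u => ?_)
      fun A hA => by rw [hspec A hA, curvatureValue_eq]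
    exact mul_pos hn0 (div_pos (mul_pos (radial_pos K u) (hpos _ (radial_pos K u) u))
      (hψpos _ (supp_pos K _)))
  -- For negative `G_t` the negated density is positive and represents `-curvatureMeasure G ψ K`.
  · refine exists_finiteMeasure_of_pos hn K (hint.const_mul (1 / (n : ℝ))).neg (fun u => ?_)
      fun A hA => by
        rw [_root_.neg_apply, hspec A hA, curvatureValue_eq, ← integral_neg]
        rfl
    exact neg_pos.2 (mul_neg_of_pos_of_neg hn0 (div_neg_of_neg_of_pos
      (mul_neg_of_pos_of_neg (radial_pos K u) (hneg _ (radial_pos K u) u))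
      (hψpos _ (supp_pos K _))))
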